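/- Let $k\ge 2$ and $1\le i\le k$ be integers, let $q$ be a complex number with $|q|<1$, and let $q^{1/2}$ be any fixed square root of $q$ (so $q^{m/2}$ means $(q^{1/2})^m$). Write $(a;q)_n=\prod_{m=0}^{n-1}(1-aq^m)$, $(a;q)_\infty=\prod_{m\ge 0}(1-aq^m)$, $(a_1,a_2,a_3;q)_\infty=(a_1;q)_\infty(a_2;q)_\infty(a_3;q)_\infty$, with the convention $1/(q;q)_n=0$ for $n<0$. Then the following multiple series converges absolutely and $$ \sum_{s_1,\ldots,s_{k-1}\ge 0} \frac{q^{s_1^2+\cdots+s_{k-1}^2-(s_i+\cdots+s_{k-1})/2}} {(q;q)_{s_1-s_2}(q;q)_{s_2-s_3}\cdots (q;q)_{s_{k-2}-s_{k-1}}\,(q^{1/2};q^{1/2})_{2s_{k-1}}} =\frac{(q^{2i},-q^{i-1/2},-q^{i+1/2};q^{2i})_\infty}{(q;q)_\infty}, $$ where the linear term $s_i+\cdots+s_{k-1}$ is $0$ if $i=k$. -/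

import Mathlib

/-- The finite `q`-shifted factorial `(a; q)_n = ∏_{m=0}^{n-1} (1 - a q^m)`. -/
noncomputable def qPoch (a q : ℂ) (n : ℕ) : ℂ :=
  ∏ m ∈ Finset.range n, (1 - a * q ^ m)

/-- The infinite `q`-shifted factorial `(a; q)_∞ = ∏_{m ≥ 0} (1 - a q^m)`. It is used for
`‖q‖ < 1` only, where the product converges (`multipliable_qPochInf`). -/
noncomputable def qPochInf (a q : ℂ) : ℂ :=
  ∏' m : ℕ, (1 - a * q ^ m)

theorem multipliable_qPochInf (a q : ℂ) (hq : ‖q‖ < 1) :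
    Multipliable fun m : ℕ => 1 - a * q ^ m := by
  have h : Summable fun m : ℕ => ‖-(a * q ^ m)‖ := by
    simp only [norm_neg, norm_mul, norm_pow]
    exact (summable_geometric_of_lt_one (norm_nonneg q) hq).mul_left _
  simpa [sub_eq_add_neg] using multipliable_one_add_of_summable h

/-- The reciprocal `1 / (q; q)_n` for an integer `n`, with the standard convention that
`1 / (q; q)_n = 0` for `n < 0`. -/
noncomputable def invQFactorial (q : ℂ) (n : ℤ) : ℂ :=
  if n < 0 then 0 else 1 / qPoch q q n.toNat

/-- The entry `s_j` of a tuple `s = (s_1, …, s_n)`, numbered from `1`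
(the value for `j` outside `1, …, n` is `0` and is never used). -/
def entry {n : ℕ} (s : Fin n → ℕ) (j : ℕ) : ℕ :=
  if h : 1 ≤ j ∧ j ≤ n then s ⟨j - 1, by omega⟩ else 0

/-- The summand of the multisum at `s = (s_1, …, s_{k-1})`, written in terms of a square root
`t = q^{1/2}`, so `q = t ^ 2`. The exponent of `t` is twice
`s_1² + ⋯ + s_{k-1}² - (s_i + ⋯ + s_{k-1}) / 2`; the linear part is empty if `i = k`. -/
noncomputable def multisumTerm (k i : ℕ) (t : ℂ) (s : Fin (k - 1) → ℕ) : ℂ :=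
  t ^ (2 * ∑ j ∈ Finset.Icc 1 (k - 1), (entry s j : ℤ) ^ 2
      - ∑ j ∈ Finset.Icc i (k - 1), (entry s j : ℤ))
    * (∏ j ∈ Finset.Icc 1 (k - 2),
        invQFactorial (t ^ 2) ((entry s j : ℤ) - (entry s (j + 1) : ℤ)))
    * (1 / qPoch t t (2 * entry s (k - 1)))

/-! The proof runs a Bailey chain at `a = 1`, with `t = q^{1/2}` and `c = i - 1`, from the innermost
variable outwards. Summing over a variable that carries the linear term reproduces `1 / (t; t)_{2n}`
(`sum_linear_step`). This quantity is also a Bailey sum, with weights `t^{2r² + r}`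
(`baileySum_zero`), and each of the `c` outer variables without linear term adds `2r²` to the
exponent (`sum_baileySum`). Hence the chain with outer factor `1 / (q; q)_{n - s₁}` sums to
`baileySum t c n` (`hasSum_chainTerm`). As `n → ∞`, dominated convergence turns this into multisum /
`(q; q)_∞` = theta series / `(q; q)_∞²`. The theta series `∑ t^{2(c+1)r² + r}` factors by the Jacobi
triple product (`tsum_quadratic_eq`). -/

theorem qPoch_zero (a q : ℂ) : qPoch a q 0 = 1 := by simp [qPoch]

theorem qPoch_succ (a q : ℂ) (n : ℕ) : qPoch a q (n + 1) = qPoch a q n * (1 - a * q ^ n) := by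
  simp [qPoch, Finset.prod_range_succ]

theorem qPoch_succ' (a q : ℂ) (n : ℕ) : qPoch a q (n + 1) = (1 - a) * qPoch (a * q) q n := by
  simp only [qPoch, Finset.prod_range_succ', pow_zero, mul_one]
  rw [mul_comm]
  congr 1
  exact Finset.prod_congr rfl fun m _ => by ring

theorem qPoch_add (a q : ℂ) (m n : ℕ) :
    qPoch a q (m + n) = qPoch a q m * qPoch (a * q ^ m) q n := by
  simp only [qPoch, Finset.prod_range_add]
  congr 1
  exact Finset.prod_congr rfl fun m _ => by ring

theorem one_sub_mul_pow_ne_zero {a q : ℂ} (ha : ‖a‖ < 1) (hq : ‖q‖ < 1) (m : ℕ) :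
    1 - a * q ^ m ≠ 0 := by
  intro h
  have h1 : a * q ^ m = 1 := (sub_eq_zero.mp h).symm
  have h2 : ‖a‖ * ‖q‖ ^ m = 1 := by rw [← norm_pow, ← norm_mul, h1, norm_one]
  have h3 : ‖q‖ ^ m ≤ 1 := pow_le_one₀ (norm_nonneg q) hq.le
  nlinarith [norm_nonneg a]

theorem qPoch_ne_zero {a q : ℂ} (ha : ‖a‖ < 1) (hq : ‖q‖ < 1) (n : ℕ) : qPoch a q n ≠ 0 :=
  Finset.prod_ne_zero_iff.mpr fun m _ => one_sub_mul_pow_ne_zero ha hq m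

/-- `(t; t)_{2n} = (t; t²)_n (t²; t²)_n`. -/
theorem qPoch_two_mul (t : ℂ) (n : ℕ) :
    qPoch t t (2 * n) = qPoch t (t ^ 2) n * qPoch (t ^ 2) (t ^ 2) n := by
  induction n with
  | zero => simp [qPoch_zero]
  | succ n ih =>
    rw [show 2 * (n + 1) = 2 * n + 1 + 1 by ring, qPoch_succ, qPoch_succ, qPoch_succ, qPoch_succ, ih]
    ring

/-- `(t²; t²)_n = (t; t)_n (-t; t)_n`. -/
theorem qPoch_sq (t : ℂ) (n : ℕ) :
    qPoch (t ^ 2) (t ^ 2) n = qPoch t t n * qPoch (-t) t n := by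
  simp only [qPoch, ← Finset.prod_mul_distrib]
  exact Finset.prod_congr rfl fun m _ => by ring

/-! ### Gaussian binomials and finite `q`-identities. -/

/-- Gaussian binomial coefficients, by the `q`-Pascal rule. -/
noncomputable def qBinom (q : ℂ) : ℕ → ℕ → ℂ
  | _, 0 => 1
  | 0, _ + 1 => 0
  | n + 1, k + 1 => q ^ (k + 1) * qBinom q n (k + 1) + qBinom q n k

theorem qBinom_zero_right (q : ℂ) (n : ℕ) : qBinom q n 0 = 1 := by cases n <;> rfl

theorem qBinom_succ_succ (q : ℂ) (n k : ℕ) :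
    qBinom q (n + 1) (k + 1) = q ^ (k + 1) * qBinom q n (k + 1) + qBinom q n k := rfl

theorem qBinom_eq_zero (q : ℂ) {n k : ℕ} (h : n < k) : qBinom q n k = 0 := by
  induction n generalizing k with
  | zero => obtain ⟨k, rfl⟩ := Nat.exists_eq_add_of_lt h; simp [qBinom]
  | succ n ih =>
    obtain ⟨k, rfl⟩ : ∃ l, k = l + 1 := ⟨k - 1, by omega⟩
    rw [qBinom_succ_succ, ih (by omega), ih (by omega)]
    simp

theorem qBinom_self (q : ℂ) (n : ℕ) : qBinom q n n = 1 := by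
  induction n with
  | zero => rfl
  | succ n ih => rw [qBinom_succ_succ, qBinom_eq_zero q (Nat.lt_succ_self n), ih]; simp

theorem qBinom_add_mul (q : ℂ) (a b : ℕ) :
    qBinom q (a + b) a * (qPoch q q a * qPoch q q b) = qPoch q q (a + b) := by
  induction hN : a + b generalizing a b with
  | zero =>
    obtain ⟨rfl, rfl⟩ : a = 0 ∧ b = 0 := by omega
    simp [qBinom_zero_right, qPoch_zero]
  | succ N ih =>
    rcases a with _ | a
    · obtain rfl : b = N + 1 := by omega
      simp [qBinom_zero_right, qPoch_zero]
    rcases b with _ | b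
    · obtain rfl : a = N := by omega
      simp [qBinom_self, qPoch_zero]
    obtain rfl : N = a + b + 1 := by omega
    have h1 := ih (a + 1) b (by ring)
    have h2 := ih a (b + 1) (by ring)
    rw [qBinom_succ_succ, qPoch_succ q q (a + b + 1)]
    have e1 := qPoch_succ q q a
    have e2 := qPoch_succ q q b
    calc _ = q ^ (a + 1) * (1 - q * q ^ b) *
            (qBinom q (a + b + 1) (a + 1) * (qPoch q q (a + 1) * qPoch q q b)) +
          (1 - q * q ^ a) * (qBinom q (a + b + 1) a * (qPoch q q a * qPoch q q (b + 1))) := by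
          rw [e2, e1]; ring
      _ = _ := by rw [h1, h2]; ring

/-- Pascal's rule in summed form; it drives the inductions on `N` below. -/
theorem sum_qBinom_succ (q : ℂ) (N : ℕ) (f : ℕ → ℂ) :
    ∑ j ∈ Finset.range (N + 2), qBinom q (N + 1) j * f j =
      ∑ j ∈ Finset.range (N + 1), q ^ j * qBinom q N j * f j +
        ∑ j ∈ Finset.range (N + 1), qBinom q N j * f (j + 1) := by
  have h : ∑ j ∈ Finset.range (N + 1), q ^ j * qBinom q N j * f j =
      ∑ j ∈ Finset.range (N + 2), q ^ j * qBinom q N j * f j := by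
    rw [Finset.sum_range_succ _ (N + 1), qBinom_eq_zero q (Nat.lt_succ_self N)]
    simp
  rw [h, Finset.sum_range_succ', Finset.sum_range_succ' _ (N + 1)]
  simp only [qBinom_succ_succ, add_mul, Finset.sum_add_distrib, qBinom_zero_right, pow_zero]
  ring

/-- The `q`-binomial theorem. -/
theorem qPoch_neg_eq_sum (q x : ℂ) (N : ℕ) :
    qPoch (-x) q N = ∑ j ∈ Finset.range (N + 1), qBinom q N j * (q ^ j.choose 2 * x ^ j) := by
  induction N generalizing x with
  | zero => simp [qPoch_zero, qBinom_zero_right]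
  | succ N ih =>
    rw [sum_qBinom_succ, qPoch_succ', neg_mul, ih, Finset.mul_sum, ← Finset.sum_add_distrib]
    refine Finset.sum_congr rfl fun j _ => ?_
    rw [Nat.choose_succ_succ' j 1, Nat.choose_one_right]
    ring

/-- Cauchy's identity: the finite Durfee square expansion of `1 / (b; q)_N`. -/
theorem sum_qBinom_div_qPoch (q b : ℂ) (N : ℕ) (hb : ∀ m : ℕ, 1 - b * q ^ m ≠ 0) :
    ∑ j ∈ Finset.range (N + 1), qBinom q N j * (q ^ (j * (j - 1)) * b ^ j / qPoch b q j) =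
      1 / qPoch b q N := by
  induction N generalizing b with
  | zero => simp [qPoch_zero, qBinom_zero_right]
  | succ N ih =>
    have hb' : ∀ m : ℕ, 1 - b * q * q ^ m ≠ 0 := fun m => by
      simpa [pow_succ', mul_assoc] using hb (m + 1)
    have hb0 : 1 - b ≠ 0 := by simpa using hb 0
    have hne : ∀ j, qPoch (b * q) q j ≠ 0 := fun j =>
      Finset.prod_ne_zero_iff.mpr fun m _ => hb' m
    have hne' : ∀ j, qPoch b q j ≠ 0 := fun j => Finset.prod_ne_zero_iff.mpr fun m _ => hb m
    rw [sum_qBinom_succ, qPoch_succ', ← div_div, div_right_comm, ← ih _ hb', Finset.sum_div,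
      ← Finset.sum_add_distrib]
    refine Finset.sum_congr rfl fun j _ => ?_
    have e : 1 / qPoch b q j = (1 - b * q ^ j) / ((1 - b) * qPoch (b * q) q j) := by
      rw [← qPoch_succ', qPoch_succ, div_eq_div_iff (hne' _) (mul_ne_zero (hne' _) (hb j))]
      ring
    -- The two Pascal terms share a common factor, with coefficients `1 - b q^j` and `b q^j`, which
    -- add up to `1`.
    rw [← mul_one_div _ (qPoch b q j), e, qPoch_succ']
    have e2 : (j + 1) * (j + 1 - 1) = j * (j - 1) + 2 * j := by
      rcases j with _ | j
      · simp
      · simp only [Nat.add_sub_cancel]; ring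
    rw [e2]
    have := hne j
    field_simp
    ring

theorem invQFactorial_natCast (q : ℂ) (n : ℕ) : invQFactorial q n = 1 / qPoch q q n := by
  simp [invQFactorial]

theorem invQFactorial_of_neg (q : ℂ) {n : ℤ} (hn : n < 0) : invQFactorial q n = 0 := by
  simp [invQFactorial, hn]

theorem qBinom_eq {q : ℂ} (hq : ‖q‖ < 1) {N j : ℕ} (h : j ≤ N) :
    qBinom q N j = qPoch q q N * (1 / qPoch q q j * (1 / qPoch q q (N - j))) := by
  obtain ⟨b, rfl⟩ := Nat.exists_eq_add_of_le h
  have h1 := qPoch_ne_zero hq hq j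
  have h2 := qPoch_ne_zero hq hq b
  rw [← qBinom_add_mul, Nat.add_sub_cancel_left]
  field_simp

theorem qBinom_symm {q : ℂ} (hq : ‖q‖ < 1) {N j : ℕ} (h : j ≤ N) :
    qBinom q N (N - j) = qBinom q N j := by
  rw [qBinom_eq hq h, qBinom_eq hq (Nat.sub_le N j), Nat.sub_sub_self h]
  ring

theorem triangular_succ (m : ℤ) : (m + 1) * (m + 1 + 1) / 2 = m * (m + 1) / 2 + (m + 1) := by
  rw [show (m + 1) * (m + 1 + 1) = m * (m + 1) + (m + 1) * 2 by ring,
    Int.add_mul_ediv_right _ _ two_ne_zero]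

/-- `∑_j t^{m(m+1)/2} [N, j]_{t²} = (-t; t)_N`, where `m = N - 2j`. -/
theorem sum_triangular_qBinom {t : ℂ} (ht : ‖t‖ < 1) (ht0 : t ≠ 0) (N : ℕ) :
    ∑ j ∈ Finset.range (N + 1),
      qBinom (t ^ 2) N j * t ^ (((N : ℤ) - 2 * j) * ((N : ℤ) - 2 * j + 1) / 2) =
      qPoch (-t) t N := by
  have hq : ‖t ^ 2‖ < 1 := by
    rw [norm_pow]; exact pow_lt_one₀ (norm_nonneg t) ht two_ne_zero
  induction N with
  | zero => simp [qPoch_zero, qBinom_zero_right]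
  | succ N ih =>
    rw [sum_qBinom_succ (t ^ 2) N
      fun j => t ^ ((((N + 1 : ℕ) : ℤ) - 2 * j) * (((N + 1 : ℕ) : ℤ) - 2 * j + 1) / 2),
      qPoch_succ, neg_mul, sub_neg_eq_add, mul_add, mul_one, add_comm]
    congr 1
    -- This half has `m - 1` in place of `m`; reflecting `j` to `N - j` sends `m` to `-m`, and
    -- `(-m)(-m+1)/2 = (m-1)m/2`.
    · rw [← ih, ← Finset.sum_range_reflect]
      refine Finset.sum_congr rfl fun j hj => ?_
      have hj' : j ≤ N := by have := Finset.mem_range.mp hj; omega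
      rw [show N + 1 - 1 - j = N - j by omega, qBinom_symm hq hj']
      congr 2
      push_cast [Nat.cast_sub hj']
      congr 1
      ring
    · rw [← ih, Finset.sum_mul]
      refine Finset.sum_congr rfl fun j _ => ?_
      -- Raising `m` to `m + 1` costs `t^{N+1-2j}`, and the Pascal weight `t^{2j}` makes this
      -- `t^{N+1}`, independent of `j`.
      have e : (((N + 1 : ℕ) : ℤ) - 2 * j) = (N : ℤ) - 2 * j + 1 := by push_cast; ring
      rw [e, triangular_succ, zpow_add₀ ht0,
        show (N : ℤ) - 2 * j + 1 = ((N + 1 : ℕ) : ℤ) - ((2 * j : ℕ) : ℤ) by push_cast; ring,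
        zpow_sub₀ ht0, zpow_natCast, zpow_natCast, ← pow_mul, pow_succ']
      field_simp
      ring

theorem norm_sq_lt_one {t : ℂ} (ht : ‖t‖ < 1) : ‖t ^ 2‖ < 1 := by
  rw [norm_pow]; exact pow_lt_one₀ (norm_nonneg t) ht two_ne_zero

/-! ### The Bailey chain at finite level. -/

/-- The conjugate Bailey identity at `a = 1`, for natural `r`. -/
theorem sum_bailey_nat {q : ℂ} (hq : ‖q‖ < 1) (n r : ℕ) :
    ∑ s ∈ Finset.range (n + 1), invQFactorial q ((n : ℤ) - s) *
      (q ^ s ^ 2 * (invQFactorial q ((s : ℤ) - r) * invQFactorial q ((s : ℤ) + r))) =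
      q ^ r ^ 2 * (invQFactorial q ((n : ℤ) - r) * invQFactorial q ((n : ℤ) + r)) := by
  rcases lt_or_ge n r with h | h
  · rw [invQFactorial_of_neg q (by omega : (n : ℤ) - r < 0)]
    simp only [zero_mul, mul_zero]
    refine Finset.sum_eq_zero fun s hs => ?_
    have := Finset.mem_range.mp hs
    rw [invQFactorial_of_neg q (by omega : (s : ℤ) - r < 0)]
    simp
  obtain ⟨N, rfl⟩ := Nat.exists_eq_add_of_le h
  -- With `n = r + N` and `s = r + j`, this is Cauchy's identity at `b = q^{2r+1}`.
  have hb : ∀ m : ℕ, 1 - q * q ^ (2 * r) * q ^ m ≠ 0 := fun m => by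
    rw [mul_assoc, ← pow_add]; exact one_sub_mul_pow_ne_zero hq hq _
  have hadd : ∀ j, qPoch q q (2 * r + j) = qPoch q q (2 * r) * qPoch (q * q ^ (2 * r)) q j :=
    fun j => qPoch_add q q (2 * r) j
  rw [add_assoc, Finset.sum_range_add, Finset.sum_eq_zero, zero_add]
  swap
  · intro s hs
    have := Finset.mem_range.mp hs
    rw [invQFactorial_of_neg q (by omega : (s : ℤ) - r < 0)]
    simp
  rw [show ((r + N : ℕ) : ℤ) - r = (N : ℕ) by push_cast; ring,
    show ((r + N : ℕ) : ℤ) + r = (2 * r + N : ℕ) by push_cast; ring,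
    invQFactorial_natCast, invQFactorial_natCast, hadd, ← div_div,
    div_eq_mul_one_div (1 / qPoch q q (2 * r)),
    ← sum_qBinom_div_qPoch q _ N hb, Finset.mul_sum, Finset.mul_sum, Finset.mul_sum]
  refine Finset.sum_congr rfl fun j hj => ?_
  have hj' : j ≤ N := by have := Finset.mem_range.mp hj; omega
  rw [show ((r + N : ℕ) : ℤ) - (r + j : ℕ) = (N - j : ℕ) by push_cast [Nat.cast_sub hj']; ring,
    show ((r + j : ℕ) : ℤ) - r = (j : ℕ) by push_cast; ring,
    show ((r + j : ℕ) : ℤ) + r = (2 * r + j : ℕ) by push_cast; ring,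
    invQFactorial_natCast, invQFactorial_natCast, invQFactorial_natCast, hadd, qBinom_eq hq hj']
  have e : (r + j) ^ 2 = r ^ 2 + (j * (j - 1) + (j + 2 * r * j)) := by
    rcases j with _ | j
    · simp
    · simp only [Nat.add_sub_cancel]; ring
  rw [e, pow_add q (r ^ 2), pow_add q (j * (j - 1)), mul_pow, ← pow_mul, ← pow_add q j]
  have := qPoch_ne_zero hq hq N
  field_simp

/-- The conjugate Bailey identity at `a = 1`. -/
theorem sum_bailey {q : ℂ} (hq : ‖q‖ < 1) (n : ℕ) (r : ℤ) :
    ∑ s ∈ Finset.range (n + 1), invQFactorial q ((n : ℤ) - s) *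
      (q ^ s ^ 2 * (invQFactorial q ((s : ℤ) - r) * invQFactorial q ((s : ℤ) + r))) =
      q ^ r.natAbs ^ 2 * (invQFactorial q ((n : ℤ) - r) * invQFactorial q ((n : ℤ) + r)) := by
  obtain ⟨m, rfl | rfl⟩ := r.eq_nat_or_neg
  · simpa using sum_bailey_nat hq n m
  · have := sum_bailey_nat hq n m
    simp only [sub_neg_eq_add, ← sub_eq_add_neg, Int.natAbs_neg, Int.natAbs_natCast]
    rw [mul_comm (invQFactorial q ((n : ℤ) + m)), ← this]
    exact Finset.sum_congr rfl fun s _ => by ring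

/-- Cauchy's identity in base `t²` at `b = t`: `1 / (t; t)_{2n}` is a fixed point of the step with a
linear term. -/
theorem sum_linear_step {t : ℂ} (ht : ‖t‖ < 1) (n : ℕ) :
    ∑ s ∈ Finset.range (n + 1), invQFactorial (t ^ 2) ((n : ℤ) - s) *
      (t ^ (2 * (s * (s - 1)) + s) * (1 / qPoch t t (2 * s))) = 1 / qPoch t t (2 * n) := by
  have hq := norm_sq_lt_one ht
  rw [qPoch_two_mul, mul_comm, ← div_div, div_eq_mul_one_div, div_mul_eq_mul_div, one_mul]
  rw [← sum_qBinom_div_qPoch (t ^ 2) t n fun m => one_sub_mul_pow_ne_zero ht hq m, Finset.sum_div]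
  refine Finset.sum_congr rfl fun s hs => ?_
  have hs' : s ≤ n := by have := Finset.mem_range.mp hs; omega
  rw [show (n : ℤ) - s = (n - s : ℕ) by push_cast [Nat.cast_sub hs']; ring, invQFactorial_natCast,
    qPoch_two_mul, qBinom_eq hq hs', pow_add, pow_mul]
  have := qPoch_ne_zero hq hq n
  field_simp

/-- The Bailey transform of `t^{2(c+1)r² + r}` relative to `a = 1` and base `t²`. -/
noncomputable def baileySum (t : ℂ) (c n : ℕ) : ℂ :=
  ∑ r ∈ Finset.Icc (-n : ℤ) n, t ^ (2 * ((c : ℤ) + 1) * r ^ 2 + r) *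
    (invQFactorial (t ^ 2) ((n : ℤ) - r) * invQFactorial (t ^ 2) ((n : ℤ) + r))

theorem baileySum_eq_sum_of_le (t : ℂ) (c : ℕ) {n M : ℕ} (h : n ≤ M) :
    baileySum t c n = ∑ r ∈ Finset.Icc (-M : ℤ) M, t ^ (2 * ((c : ℤ) + 1) * r ^ 2 + r) *
      (invQFactorial (t ^ 2) ((n : ℤ) - r) * invQFactorial (t ^ 2) ((n : ℤ) + r)) := by
  refine Finset.sum_subset (Finset.Icc_subset_Icc (by omega) (by omega)) fun r _ hr => ?_
  rw [Finset.mem_Icc, not_and_or] at hr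
  rcases hr with hr | hr
  · rw [invQFactorial_of_neg _ (by omega : (n : ℤ) + r < 0)]; simp
  · rw [invQFactorial_of_neg _ (by omega : (n : ℤ) - r < 0)]; simp

/-- Exchanging the sums leaves the conjugate Bailey identity for each `r`, whose factor `q^{r²} =
t^{2r²}` raises `c` by one. -/
theorem sum_baileySum {t : ℂ} (ht : ‖t‖ < 1) (ht0 : t ≠ 0) (c n : ℕ) :
    ∑ s ∈ Finset.range (n + 1), invQFactorial (t ^ 2) ((n : ℤ) - s) *
      (t ^ (2 * s ^ 2) * baileySum t c s) = baileySum t (c + 1) n := by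
  have h : ∀ s ∈ Finset.range (n + 1), invQFactorial (t ^ 2) ((n : ℤ) - s) *
      (t ^ (2 * s ^ 2) * baileySum t c s) = ∑ r ∈ Finset.Icc (-n : ℤ) n,
        t ^ (2 * ((c : ℤ) + 1) * r ^ 2 + r) * (invQFactorial (t ^ 2) ((n : ℤ) - s) *
          ((t ^ 2) ^ s ^ 2 *
            (invQFactorial (t ^ 2) ((s : ℤ) - r) * invQFactorial (t ^ 2) ((s : ℤ) + r)))) := by
    intro s hs
    rw [baileySum_eq_sum_of_le t c (by have := Finset.mem_range.mp hs; omega : s ≤ n),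
      Finset.mul_sum, Finset.mul_sum]
    refine Finset.sum_congr rfl fun r _ => ?_
    rw [← pow_mul]; ring
  rw [Finset.sum_congr rfl h, Finset.sum_comm, baileySum]
  refine Finset.sum_congr rfl fun r _ => ?_
  rw [← Finset.mul_sum, sum_bailey (norm_sq_lt_one ht), ← mul_assoc]
  congr 1
  rw [← pow_mul, ← zpow_natCast, ← zpow_add₀ ht0]
  congr 1
  push_cast
  rw [sq_abs]
  ring

theorem sum_Icc_neg_eq_sum_range (n : ℕ) (f : ℤ → ℂ) :
    ∑ r ∈ Finset.Icc (-n : ℤ) n, f r = ∑ j ∈ Finset.range (2 * n + 1), f ((n : ℤ) - j) := by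
  refine Finset.sum_bij' (fun r _ => ((n : ℤ) - r).toNat) (fun j _ => (n : ℤ) - j) ?_ ?_ ?_ ?_ ?_
  · intro r hr; simp only [Finset.mem_Icc, Finset.mem_range] at *; omega
  · intro r hr; simp only [Finset.mem_Icc, Finset.mem_range] at *; omega
  · intro r hr; simp only [Finset.mem_Icc] at *; omega
  · intro r hr; simp only [Finset.mem_range] at *; omega
  · intro r hr; simp only [Finset.mem_Icc] at *; congr 1; omega

theorem invQFactorial_mul_eq {q : ℂ} (hq : ‖q‖ < 1) {n j : ℕ} (hj : j ≤ 2 * n) :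
    invQFactorial q ((n : ℤ) - (n - j)) * invQFactorial q ((n : ℤ) + (n - j)) =
      qBinom q (2 * n) j / qPoch q q (2 * n) := by
  rw [show (n : ℤ) - (n - j) = (j : ℕ) by ring,
    show (n : ℤ) + (n - j) = (2 * n - j : ℕ) by push_cast [Nat.cast_sub hj]; ring,
    invQFactorial_natCast, invQFactorial_natCast, qBinom_eq hq hj]
  have := qPoch_ne_zero hq hq (2 * n)
  field_simp

theorem baileySum_zero {t : ℂ} (ht : ‖t‖ < 1) (ht0 : t ≠ 0) (n : ℕ) :
    baileySum t 0 n = 1 / qPoch t t (2 * n) := by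
  have hq := norm_sq_lt_one ht
  have h1 := qPoch_ne_zero ht ht (2 * n)
  have h2 : qPoch (-t) t (2 * n) ≠ 0 := qPoch_ne_zero (by simpa using ht) ht _
  have e : 1 / qPoch t t (2 * n) = qPoch (-t) t (2 * n) / qPoch (t ^ 2) (t ^ 2) (2 * n) := by
    rw [qPoch_sq]; field_simp
  rw [e, baileySum, sum_Icc_neg_eq_sum_range, ← sum_triangular_qBinom ht ht0, Finset.sum_div]
  refine Finset.sum_congr rfl fun j hj => ?_
  have hj' : j ≤ 2 * n := by have := Finset.mem_range.mp hj; omega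
  rw [invQFactorial_mul_eq hq hj']
  -- For `N = 2n` and `r = n - j` the triangular index is `m = 2r`, so `m(m+1)/2 = 2r² + r`.
  have e2 : (((2 * n : ℕ) : ℤ) - 2 * j) * (((2 * n : ℕ) : ℤ) - 2 * j + 1) / 2 =
      2 * (((0 : ℕ) : ℤ) + 1) * ((n : ℤ) - j) ^ 2 + ((n : ℤ) - j) := by
    rw [show (((2 * n : ℕ) : ℤ) - 2 * j) * (((2 * n : ℕ) : ℤ) - 2 * j + 1) =
      (2 * (((0 : ℕ) : ℤ) + 1) * ((n : ℤ) - j) ^ 2 + ((n : ℤ) - j)) * 2 by push_cast; ring,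
      Int.mul_ediv_cancel _ two_ne_zero]
  rw [e2]
  ring

/-! ### Limits and uniform bounds for the reciprocal factorials. -/

open Filter Topology

theorem tendsto_qPoch (a : ℂ) {q : ℂ} (hq : ‖q‖ < 1) :
    Tendsto (qPoch a q) atTop (𝓝 (qPochInf a q)) :=
  (multipliable_qPochInf a q hq).hasProd.tendsto_prod_nat

theorem qPochInf_ne_zero {a q : ℂ} (ha : ‖a‖ < 1) (hq : ‖q‖ < 1) : qPochInf a q ≠ 0 := by
  have h : Summable fun m : ℕ => ‖-(a * q ^ m)‖ := by
    simp only [norm_neg, norm_mul, norm_pow]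
    exact (summable_geometric_of_lt_one (norm_nonneg q) hq).mul_left _
  have := tprod_one_add_ne_zero_of_summable (f := fun m : ℕ => -(a * q ^ m))
    (fun m => by simpa [sub_eq_add_neg] using one_sub_mul_pow_ne_zero ha hq m) h
  simpa [qPochInf, sub_eq_add_neg] using this

theorem exists_norm_one_div_qPoch_le {a q : ℂ} (ha : ‖a‖ < 1) (hq : ‖q‖ < 1) :
    ∃ K : ℝ, 0 ≤ K ∧ ∀ n, ‖1 / qPoch a q n‖ ≤ K := by
  obtain ⟨K, hK⟩ := ((tendsto_const_nhds (x := (1 : ℂ))).div (tendsto_qPoch a hq)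
    (qPochInf_ne_zero ha hq)).norm.bddAbove_range
  have h : ∀ n, ‖1 / qPoch a q n‖ ≤ K := fun n => hK ⟨n, rfl⟩
  exact ⟨K, (norm_nonneg _).trans (h 0), h⟩

theorem exists_norm_invQFactorial_le {q : ℂ} (hq : ‖q‖ < 1) :
    ∃ K : ℝ, 0 ≤ K ∧ ∀ n, ‖invQFactorial q n‖ ≤ K := by
  obtain ⟨K, h0, hK⟩ := exists_norm_one_div_qPoch_le hq hq
  refine ⟨K, h0, fun n => ?_⟩
  rcases lt_or_ge n 0 with h | h
  · rw [invQFactorial_of_neg q h, norm_zero]; exact h0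
  · obtain ⟨m, rfl⟩ := Int.eq_ofNat_of_zero_le h
    rw [invQFactorial_natCast]; exact hK m

theorem tendsto_invQFactorial {q : ℂ} (hq : ‖q‖ < 1) :
    Tendsto (invQFactorial q) atTop (𝓝 (1 / qPochInf q q)) := by
  have h := (tendsto_const_nhds (x := (1 : ℂ))).div (tendsto_qPoch q hq) (qPochInf_ne_zero hq hq)
  refine (h.comp (tendsto_atTop_atTop.mpr fun b => ⟨(b : ℤ), fun a ha => ?_⟩ :
    Tendsto Int.toNat atTop atTop)).congr' ?_
  · omega
  · filter_upwards [eventually_ge_atTop (0 : ℤ)] with n hn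
    simp [invQFactorial, not_lt.mpr hn]

theorem tendsto_invQFactorial_sub {q : ℂ} (hq : ‖q‖ < 1) (r : ℤ) :
    Tendsto (fun n : ℕ => invQFactorial q ((n : ℤ) - r)) atTop (𝓝 (1 / qPochInf q q)) :=
  (tendsto_invQFactorial hq).comp
    (tendsto_atTop_add_const_right _ (-r) tendsto_natCast_atTop_atTop)

theorem tendsto_invQFactorial_add {q : ℂ} (hq : ‖q‖ < 1) (r : ℤ) :
    Tendsto (fun n : ℕ => invQFactorial q ((n : ℤ) + r)) atTop (𝓝 (1 / qPochInf q q)) := by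
  simpa using tendsto_invQFactorial_sub hq (-r)

/-! ### Summation of the iterated chain. -/

/-- The summand of the iterated Bailey chain of length `m`, whose first `c` steps have no linear
term in the exponent, with an outer factor `1 / (t²; t²)_{n - s₁}`. -/
noncomputable def chainTerm (t : ℂ) : (m : ℕ) → ℕ → ℕ → (Fin m → ℕ) → ℂ
  | 0, _, n, _ => 1 / qPoch t t (2 * n)
  -- The exponent is `2s² - s` or `2s²`, also at `s = 0`. Truncation keeps `c - 1` at `0`, so after
  -- the first `c` steps every step has the linear term.
  | m + 1, c, n, s => invQFactorial (t ^ 2) ((n : ℤ) - s 0) *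
      (t ^ (2 * (s 0 * (s 0 - 1)) + if c = 0 then s 0 else 2 * s 0) *
        chainTerm t m (c - 1) (s 0) (Fin.tail s))

theorem summable_prod_pow {x : ℝ} (hx0 : 0 ≤ x) (hx : x < 1) (m : ℕ) :
    Summable fun s : Fin m → ℕ => ∏ j, x ^ s j := by
  induction m with
  | zero => exact (hasSum_fintype _).summable
  | succ m ih =>
    rw [← (Fin.consEquiv fun _ : Fin (m + 1) => ℕ).summable_iff]
    refine ((summable_geometric_of_lt_one hx0 hx).mul_of_nonneg ih (fun n => pow_nonneg hx0 n)
      fun s => Finset.prod_nonneg fun j _ => pow_nonneg hx0 _).congr fun p => ?_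
    simp [Fin.consEquiv, Fin.prod_univ_succ]

/-- Every step has exponent at least `s 0`. Uniformity in `n` supplies the dominating series for the
limit `n → ∞`. -/
theorem exists_norm_chainTerm_le {t : ℂ} (ht : ‖t‖ < 1) (m : ℕ) :
    ∃ K : ℝ, 0 ≤ K ∧ ∀ c n (s : Fin m → ℕ), ‖chainTerm t m c n s‖ ≤ K * ∏ j, ‖t‖ ^ s j := by
  obtain ⟨A, hA0, hA⟩ := exists_norm_invQFactorial_le (norm_sq_lt_one ht)
  induction m with
  | zero =>
    obtain ⟨K, h0, hK⟩ := exists_norm_one_div_qPoch_le ht ht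
    exact ⟨K, h0, fun c n s => by simpa [chainTerm] using hK (2 * n)⟩
  | succ m ih =>
    obtain ⟨K, h0, hK⟩ := ih
    refine ⟨A * K, mul_nonneg hA0 h0, fun c n s => ?_⟩
    rw [chainTerm, norm_mul, norm_mul, norm_pow, Fin.prod_univ_succ, mul_assoc, mul_left_comm K]
    refine mul_le_mul (hA _) (mul_le_mul (pow_le_pow_of_le_one (norm_nonneg t) ht.le ?_)
      (hK _ _ _) (norm_nonneg _) (by positivity)) (by positivity) hA0
    split_ifs <;> omega

theorem chainTerm_cons (t : ℂ) (m c n a : ℕ) (s : Fin m → ℕ) :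
    chainTerm t (m + 1) c n (Fin.cons a s : Fin (m + 1) → ℕ) =
      invQFactorial (t ^ 2) ((n : ℤ) - a) *
        (t ^ (2 * (a * (a - 1)) + if c = 0 then a else 2 * a) * chainTerm t m (c - 1) a s) := by
  simp only [chainTerm, Fin.cons_zero, Fin.tail_cons]

theorem summable_chainTerm {t : ℂ} (ht : ‖t‖ < 1) (m c n : ℕ) :
    Summable (chainTerm t m c n) := by
  obtain ⟨K, -, hK⟩ := exists_norm_chainTerm_le ht m
  exact Summable.of_norm_bounded ((summable_prod_pow (norm_nonneg t) ht m).mul_left K) (hK c n)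

theorem hasSum_chainTerm {t : ℂ} (ht : ‖t‖ < 1) (ht0 : t ≠ 0) {m c : ℕ} (hc : c ≤ m) (n : ℕ) :
    HasSum (chainTerm t m c n) (baileySum t c n) := by
  induction m generalizing c n with
  | zero =>
    obtain rfl : c = 0 := by omega
    rw [baileySum_zero ht ht0]
    simp [chainTerm]
  | succ m ih =>
    have hs := (summable_chainTerm ht (m + 1) c n).hasSum
    have hf : ∀ a : ℕ, HasSum (fun s : Fin m → ℕ => chainTerm t (m + 1) c n
        (Fin.consEquiv (fun _ : Fin (m + 1) => ℕ) (a, s))) (invQFactorial (t ^ 2) ((n : ℤ) - a) *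
          (t ^ (2 * (a * (a - 1)) + if c = 0 then a else 2 * a) * baileySum t (c - 1) a)) := by
      intro a
      refine (((ih (c := c - 1) (by omega) a).mul_left _).mul_left _).congr_fun ?_
      exact fun s => chainTerm_cons t m c n a s
    have h := ((Fin.consEquiv fun _ : Fin (m + 1) => ℕ).hasSum_iff.mpr hs).prod_fiberwise hf
    have h2 : ∑' a : ℕ, invQFactorial (t ^ 2) ((n : ℤ) - a) *
      (t ^ (2 * (a * (a - 1)) + if c = 0 then a else 2 * a) * baileySum t (c - 1) a) =
        baileySum t c n := by
      -- The factor `1 / (q; q)_{n - a}` vanishes for `a > n`, so only the finite identities are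
      -- needed.
      rw [tsum_eq_sum (s := Finset.range (n + 1))]
      · rcases c with _ | c
        · simp only [if_true, Nat.zero_sub, baileySum_zero ht ht0]
          exact sum_linear_step ht n
        · rw [← sum_baileySum ht ht0]
          refine Finset.sum_congr rfl fun a _ => ?_
          rw [if_neg (Nat.succ_ne_zero c), Nat.add_sub_cancel]
          congr 3
          rcases a with _ | a
          · rfl
          · simp only [Nat.add_sub_cancel]; ring
      · intro a ha
        rw [invQFactorial_of_neg _ (by rw [Finset.mem_range] at ha; omega), zero_mul]
    rwa [← h2, h.tsum_eq]

/-! ### Theta series and the Jacobi triple product. -/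

theorem summable_pow_natAbs {x : ℝ} (hx0 : 0 ≤ x) (hx : x < 1) :
    Summable fun r : ℤ => x ^ r.natAbs := by
  refine Summable.of_nat_of_neg ?_ ?_ <;>
    simpa using summable_geometric_of_lt_one hx0 hx

theorem norm_zpow_quadratic_le {t : ℂ} (ht : ‖t‖ < 1) (ht0 : t ≠ 0) (c : ℕ) (r : ℤ) :
    ‖t ^ (2 * ((c : ℤ) + 1) * r ^ 2 + r)‖ ≤ ‖t‖ ^ r.natAbs := by
  rw [norm_zpow, ← zpow_natCast]
  refine zpow_le_zpow_right_of_le_one₀ (norm_pos_iff.mpr ht0) ht.le ?_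
  have h1 : (r.natAbs : ℤ) ≤ r ^ 2 := by
    rw [← Int.natAbs_sq, sq]
    exact_mod_cast Nat.le_mul_self _
  have h2 : -(r.natAbs : ℤ) ≤ r := by omega
  have h3 : 0 ≤ (c : ℤ) * r ^ 2 := by positivity
  linarith

/-- The base `q` is independent of `t` because the limit is used twice: in base `t²` for the Bailey
sums and in base `t^{4(c+1)}` for the triple product. -/
theorem tendsto_sum_quadratic {t q : ℂ} (ht : ‖t‖ < 1) (ht0 : t ≠ 0) (hq : ‖q‖ < 1) (c : ℕ) :
    Tendsto (fun n : ℕ => ∑ r ∈ Finset.Icc (-n : ℤ) n, t ^ (2 * ((c : ℤ) + 1) * r ^ 2 + r) *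
      (invQFactorial q ((n : ℤ) - r) * invQFactorial q ((n : ℤ) + r))) atTop
      (𝓝 ((∑' r : ℤ, t ^ (2 * ((c : ℤ) + 1) * r ^ 2 + r)) *
        (1 / qPochInf q q * (1 / qPochInf q q)))) := by
  obtain ⟨A, hA0, hA⟩ := exists_norm_invQFactorial_le hq
  have e : ∀ n : ℕ, ∑ r ∈ Finset.Icc (-n : ℤ) n, t ^ (2 * ((c : ℤ) + 1) * r ^ 2 + r) *
      (invQFactorial q ((n : ℤ) - r) * invQFactorial q ((n : ℤ) + r)) =
      ∑' r : ℤ, t ^ (2 * ((c : ℤ) + 1) * r ^ 2 + r) *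
        (invQFactorial q ((n : ℤ) - r) * invQFactorial q ((n : ℤ) + r)) := by
    intro n
    rw [tsum_eq_sum (s := Finset.Icc (-n : ℤ) n)]
    intro r hr
    rw [Finset.mem_Icc, not_and_or] at hr
    rcases hr with hr | hr
    · rw [invQFactorial_of_neg _ (by omega : (n : ℤ) + r < 0)]; simp
    · rw [invQFactorial_of_neg _ (by omega : (n : ℤ) - r < 0)]; simp
  simp only [e]
  rw [← tsum_mul_right]
  refine tendsto_tsum_of_dominated_convergence
    ((summable_pow_natAbs (norm_nonneg t) ht).mul_right (A * A)) (fun r => ?_)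
    (Eventually.of_forall fun n r => ?_)
  · exact ((tendsto_invQFactorial_sub hq r).mul (tendsto_invQFactorial_add hq r)).const_mul _
  · rw [norm_mul, norm_mul]
    exact mul_le_mul (norm_zpow_quadratic_le ht ht0 c r)
      (mul_le_mul (hA _) (hA _) (norm_nonneg _) hA0) (by positivity) (by positivity)

/-- Each factor `1 + t^B` with `B < 0` is rewritten as `t^B (1 + t^{-B})`; the extracted powers
cancel the prefactor. -/
theorem zpow_mul_qPoch_shift {t : ℂ} (ht0 : t ≠ 0) (c n : ℕ) :
    t ^ (2 * ((c : ℤ) + 1) * n ^ 2 + n) *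
      qPoch (-t ^ (2 * (c : ℤ) + 1 - 4 * (c + 1) * n)) (t ^ (4 * (c + 1))) n =
      qPoch (-t ^ (2 * c + 3)) (t ^ (4 * (c + 1))) n := by
  induction n with
  | zero => simp [qPoch_zero]
  | succ n ih =>
    rw [qPoch_succ', qPoch_succ, ← ih]
    have e1 : -t ^ (2 * (c : ℤ) + 1 - 4 * (c + 1) * (n + 1 : ℕ)) * t ^ (4 * (c + 1)) =
        -t ^ (2 * (c : ℤ) + 1 - 4 * (c + 1) * n) := by
      rw [← zpow_natCast, neg_mul, ← zpow_add₀ ht0]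
      congr 2; push_cast; ring
    have e2 : t ^ (2 * ((c : ℤ) + 1) * (n + 1 : ℕ) ^ 2 + (n + 1 : ℕ)) *
        (1 - -t ^ (2 * (c : ℤ) + 1 - 4 * (c + 1) * (n + 1 : ℕ))) =
        t ^ (2 * ((c : ℤ) + 1) * n ^ 2 + n) *
          (1 - -t ^ (2 * c + 3) * (t ^ (4 * (c + 1))) ^ n) := by
      have key : ∀ A B C D : ℤ, A + B = C → A = C + D →
          t ^ A * (1 + t ^ B) = t ^ C * (1 + t ^ D) := fun A B C D h1 h2 => by
        rw [mul_add, mul_add, mul_one, mul_one, ← zpow_add₀ ht0, ← zpow_add₀ ht0, h1, ← h2,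
          add_comm]
      rw [← pow_mul, neg_mul, ← pow_add, ← zpow_natCast, sub_neg_eq_add, sub_neg_eq_add]
      exact key _ _ _ _ (by push_cast; ring) (by push_cast; ring)
    rw [e1, ← mul_assoc, e2]
    ring

/-- The finite form of the Jacobi triple product identity. -/
theorem sum_quadratic_eq_qPoch {t : ℂ} (ht : ‖t‖ < 1) (ht0 : t ≠ 0) (c n : ℕ) :
    ∑ r ∈ Finset.Icc (-n : ℤ) n, t ^ (2 * ((c : ℤ) + 1) * r ^ 2 + r) *
      (invQFactorial (t ^ (4 * (c + 1))) ((n : ℤ) - r) *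
        invQFactorial (t ^ (4 * (c + 1))) ((n : ℤ) + r)) =
      qPoch (-t ^ (2 * c + 3)) (t ^ (4 * (c + 1))) n *
        qPoch (-t ^ (2 * c + 1)) (t ^ (4 * (c + 1))) n /
          qPoch (t ^ (4 * (c + 1))) (t ^ (4 * (c + 1))) (2 * n) := by
  have hq : ‖t ^ (4 * (c + 1))‖ < 1 := by
    rw [norm_pow]; exact pow_lt_one₀ (norm_nonneg t) ht (by omega)
  have e : qPoch (-t ^ (2 * c + 1)) (t ^ (4 * (c + 1))) n =
      qPoch (-t ^ (2 * (c : ℤ) + 1 - 4 * (c + 1) * n) * (t ^ (4 * (c + 1))) ^ n)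
        (t ^ (4 * (c + 1))) n := by
    congr 1
    rw [← pow_mul, ← zpow_natCast, ← zpow_natCast, neg_mul, ← zpow_add₀ ht0]
    congr 2; push_cast; ring
  -- The two products of length `n` join into one of length `2n`, expanded by the `q`-binomial
  -- theorem; centring at `j = n - r` gives the bilateral sum.
  rw [← zpow_mul_qPoch_shift ht0, e, mul_assoc, ← qPoch_add, ← two_mul, qPoch_neg_eq_sum,
    sum_Icc_neg_eq_sum_range, Finset.mul_sum, Finset.sum_div]
  refine Finset.sum_congr rfl fun j hj => ?_
  rw [invQFactorial_mul_eq hq (by have := Finset.mem_range.mp hj; omega)]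
  have e2 : t ^ (2 * ((c : ℤ) + 1) * (n - j) ^ 2 + (n - j)) =
      t ^ (2 * ((c : ℤ) + 1) * n ^ 2 + n) * ((t ^ (4 * (c + 1))) ^ j.choose 2 *
        (t ^ (2 * (c : ℤ) + 1 - 4 * (c + 1) * n)) ^ j) := by
    have h : (2 * j.choose 2 : ℤ) = j * (j - 1) := by
      rcases j with _ | j
      · simp
      · rw [Nat.choose_two_right]
        have h := Nat.div_mul_cancel (Nat.even_mul_pred_self (j + 1)).two_dvd
        rw [Nat.add_sub_cancel] at *
        zify at h
        push_cast
        linarith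
    rw [← pow_mul, ← zpow_natCast, ← zpow_natCast, ← zpow_mul, ← zpow_add₀ ht0, ← zpow_add₀ ht0]
    congr 1
    push_cast
    linear_combination (-2 * ((c : ℤ) + 1)) * h
  rw [e2]
  ring

/-- The Jacobi triple product identity. -/
theorem tsum_quadratic_eq {t : ℂ} (ht : ‖t‖ < 1) (ht0 : t ≠ 0) (c : ℕ) :
    ∑' r : ℤ, t ^ (2 * ((c : ℤ) + 1) * r ^ 2 + r) =
      qPochInf (t ^ (4 * (c + 1))) (t ^ (4 * (c + 1))) *
        qPochInf (-t ^ (2 * c + 1)) (t ^ (4 * (c + 1))) *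
          qPochInf (-t ^ (2 * c + 3)) (t ^ (4 * (c + 1))) := by
  have hq : ‖t ^ (4 * (c + 1))‖ < 1 := by
    rw [norm_pow]; exact pow_lt_one₀ (norm_nonneg t) ht (by omega)
  have h0 := qPochInf_ne_zero hq hq
  have h1 := tendsto_sum_quadratic ht ht0 hq c
  simp only [sum_quadratic_eq_qPoch ht ht0] at h1
  have h2 := tendsto_nhds_unique h1 (((tendsto_qPoch _ hq).mul (tendsto_qPoch _ hq)).div
    ((tendsto_qPoch _ hq).comp (tendsto_id.const_mul_atTop' two_pos)) h0)
  field_simp at h2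
  linear_combination h2

/-! ### Matching the multisum with the chain. -/

theorem entry_succ {n : ℕ} (s : Fin (n + 1) → ℕ) (j : ℕ) (hj : 1 ≤ j) :
    entry s (j + 1) = entry (Fin.tail s) j := by
  unfold entry Fin.tail
  by_cases h : j ≤ n
  · rw [dif_pos (by omega), dif_pos (by omega)]
    congr 1
    ext
    simp only [Fin.val_succ]
    omega
  · rw [dif_neg (by omega), dif_neg (by omega)]

theorem entry_one {n : ℕ} (s : Fin (n + 1) → ℕ) : entry s 1 = s 0 := by
  simp [entry]

theorem multisumTerm_two (t : ℂ) (c : ℕ) (s : Fin 1 → ℕ) :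
    multisumTerm 2 (c + 1) t s =
      t ^ (2 * (s 0 * (s 0 - 1)) + if c = 0 then s 0 else 2 * s 0) *
        (1 / qPoch t t (2 * s 0)) := by
  have e : ((2 * (s 0 * (s 0 - 1)) + if c = 0 then s 0 else 2 * s 0 : ℕ) : ℤ) =
      2 * (s 0 : ℤ) ^ 2 - if c = 0 then (s 0 : ℤ) else 0 := by
    rcases s 0 with _ | a
    · simp
    · rw [Nat.add_sub_cancel]; split_ifs <;> (push_cast; ring)
  rw [← zpow_natCast, e]
  unfold multisumTerm
  rcases c with _ | c
  · simp [entry_one]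
  · simp [entry_one]

/-- Peeling off `s₁` lowers `k` by one, and `i` too unless `i = 1`; this is the recursion of
`chainTerm`. -/
theorem multisumTerm_succ {t : ℂ} (ht0 : t ≠ 0) (m c : ℕ) (s : Fin (m + 2) → ℕ) :
    multisumTerm (m + 3) (c + 1) t s =
      t ^ (2 * (s 0 * (s 0 - 1)) + if c = 0 then s 0 else 2 * s 0) *
        (invQFactorial (t ^ 2) ((s 0 : ℤ) - Fin.tail s 0) *
          multisumTerm (m + 2) (c - 1 + 1) t (Fin.tail s)) := by
  have e : ((2 * (s 0 * (s 0 - 1)) + if c = 0 then s 0 else 2 * s 0 : ℕ) : ℤ) =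
      2 * (s 0 : ℤ) ^ 2 - if c = 0 then (s 0 : ℤ) else 0 := by
    rcases s 0 with _ | a
    · simp
    · rw [Nat.add_sub_cancel]; split_ifs <;> (push_cast; ring)
  have hshift : ∀ a b : ℕ, 1 ≤ a → ∀ f : ℕ → ℤ, ∑ j ∈ Finset.Icc (a + 1) (b + 1), f j =
      ∑ j ∈ Finset.Icc a b, f (j + 1) := fun a b _ f => by
    rw [← Finset.map_add_right_Icc, Finset.sum_map]; rfl
  have h1 : ∑ j ∈ Finset.Icc 1 (m + 2), (entry s j : ℤ) ^ 2 =
      (s 0 : ℤ) ^ 2 + ∑ j ∈ Finset.Icc 1 (m + 1), (entry (Fin.tail s) j : ℤ) ^ 2 := by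
    rw [← Finset.add_sum_Ioc_eq_sum_Icc (by omega), entry_one]
    congr 1
    rw [← Finset.Icc_add_one_left_eq_Ioc, hshift _ _ le_rfl]
    exact Finset.sum_congr rfl fun j hj => by rw [entry_succ s j (Finset.mem_Icc.mp hj).1]
  have h2 : ∑ j ∈ Finset.Icc (c + 1) (m + 2), (entry s j : ℤ) =
      (if c = 0 then (s 0 : ℤ) else 0) +
        ∑ j ∈ Finset.Icc (c - 1 + 1) (m + 1), (entry (Fin.tail s) j : ℤ) := by
    rcases c with _ | c
    · rw [zero_add, ← Finset.add_sum_Ioc_eq_sum_Icc (by omega), entry_one, if_pos rfl]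
      congr 1
      rw [← Finset.Icc_add_one_left_eq_Ioc, hshift _ _ le_rfl]
      exact Finset.sum_congr rfl fun j hj => by rw [entry_succ s j (Finset.mem_Icc.mp hj).1]
    · rw [if_neg (Nat.succ_ne_zero c), zero_add, hshift _ _ (by omega), Nat.add_sub_cancel]
      exact Finset.sum_congr rfl fun j hj => by
        rw [entry_succ s j (by have := (Finset.mem_Icc.mp hj).1; omega)]
  have h3 : ∏ j ∈ Finset.Icc 1 (m + 1),
      invQFactorial (t ^ 2) ((entry s j : ℤ) - (entry s (j + 1) : ℤ)) =
      invQFactorial (t ^ 2) ((s 0 : ℤ) - Fin.tail s 0) * ∏ j ∈ Finset.Icc 1 m,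
        invQFactorial (t ^ 2) ((entry (Fin.tail s) j : ℤ) - (entry (Fin.tail s) (j + 1) : ℤ)) := by
    rw [← Finset.mul_prod_Ioc_eq_prod_Icc (by omega), entry_one, entry_succ s 1 le_rfl, entry_one]
    congr 1
    rw [← Finset.Icc_add_one_left_eq_Ioc, ← Finset.map_add_right_Icc, Finset.prod_map]
    refine Finset.prod_congr rfl fun j hj => ?_
    have hj1 := (Finset.mem_Icc.mp hj).1
    change invQFactorial _ ((entry s (j + 1) : ℤ) - entry s (j + 1 + 1)) = _
    rw [entry_succ s j hj1, entry_succ s (j + 1) (by omega)]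
  rw [← zpow_natCast, e]
  unfold multisumTerm
  simp only [show m + 3 - 1 = m + 2 by omega, show m + 3 - 2 = m + 1 by omega,
    show m + 2 - 1 = m + 1 by omega, show m + 2 - 2 = m by omega]
  rw [h1, h2, h3, entry_succ s (m + 1) (by omega), show ∀ a b x y : ℤ,
    2 * (a + b) - (x + y) = 2 * a - x + (2 * b - y) from fun a b x y => by ring, zpow_add₀ ht0]
  ring

theorem chainTerm_eq {t : ℂ} (ht0 : t ≠ 0) (m c n : ℕ) (s : Fin (m + 1) → ℕ) :
    chainTerm t (m + 1) c n s =
      invQFactorial (t ^ 2) ((n : ℤ) - s 0) * multisumTerm (m + 2) (c + 1) t s := by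
  induction m generalizing c n with
  | zero => rw [chainTerm, multisumTerm_two]; rfl
  | succ m ih => rw [chainTerm, multisumTerm_succ ht0, ih]

/-! ### Passage to the limit and the degenerate case `t = 0`. -/

theorem hasSum_multisumTerm {t : ℂ} (ht : ‖t‖ < 1) (ht0 : t ≠ 0) {m c : ℕ} (hc : c ≤ m + 1) :
    HasSum (fun s : Fin (m + 1) → ℕ => multisumTerm (m + 2) (c + 1) t s)
      ((∑' r : ℤ, t ^ (2 * ((c : ℤ) + 1) * r ^ 2 + r)) / qPochInf (t ^ 2) (t ^ 2)) := by
  have hq := norm_sq_lt_one ht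
  have h0 := qPochInf_ne_zero hq hq
  obtain ⟨K, -, hK⟩ := exists_norm_chainTerm_le ht (m + 1)
  have hsum := (summable_prod_pow (norm_nonneg t) ht (m + 1)).mul_left K
  have hM : Summable fun s : Fin (m + 1) → ℕ => multisumTerm (m + 2) (c + 1) t s := by
    refine Summable.of_norm_bounded hsum fun s => ?_
    -- At `n = s₁` the outer factor is `1 / (q; q)_0 = 1`, so the uniform bound applies to the
    -- multisum itself.
    have e : multisumTerm (m + 2) (c + 1) t s = chainTerm t (m + 1) c (s 0) s := by
      rw [chainTerm_eq ht0, sub_self, ← Nat.cast_zero (R := ℤ), invQFactorial_natCast, qPoch_zero]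
      simp
    rw [e]
    exact hK _ _ _
  have h1 : Tendsto (fun n : ℕ => ∑' s, chainTerm t (m + 1) c n s) atTop
      (𝓝 (∑' s : Fin (m + 1) → ℕ,
        1 / qPochInf (t ^ 2) (t ^ 2) * multisumTerm (m + 2) (c + 1) t s)) := by
    refine tendsto_tsum_of_dominated_convergence hsum (fun s => ?_)
      (Eventually.of_forall fun n s => hK c n s)
    simp only [chainTerm_eq ht0]
    exact (tendsto_invQFactorial_sub hq _).mul_const _
  simp only [fun n => (hasSum_chainTerm ht ht0 hc n).tsum_eq] at h1
  have h2 := tendsto_nhds_unique h1 (tendsto_sum_quadratic ht ht0 hq c)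
  rw [tsum_mul_left] at h2
  convert hM.hasSum using 1
  -- One of the two factors `1 / (q; q)_∞` from the Bailey sum cancels against the outer factor of
  -- the chain.
  field_simp at h2 ⊢
  exact h2.symm

/-- Since `s_j ≤ s_j²`, the exponent of `t` is at least `∑ s_j²`, which is positive; at `t = 0` only
`s = 0` survives. -/
theorem multisumTerm_zero_of_ne_zero (k i : ℕ) (hi : 1 ≤ i) {s : Fin (k - 1) → ℕ} (hs : s ≠ 0) :
    multisumTerm k i 0 s = 0 := by
  have h1 : ∑ j ∈ Finset.Icc i (k - 1), (entry s j : ℤ) ≤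
      ∑ j ∈ Finset.Icc 1 (k - 1), (entry s j : ℤ) ^ 2 :=
    (Finset.sum_le_sum fun j _ => by exact_mod_cast Nat.le_self_pow two_ne_zero _).trans
      (Finset.sum_le_sum_of_subset_of_nonneg (Finset.Icc_subset_Icc_left hi)
        fun j _ _ => sq_nonneg _)
  have h2 : 0 < ∑ j ∈ Finset.Icc 1 (k - 1), (entry s j : ℤ) ^ 2 := by
    obtain ⟨a, ha⟩ := Function.ne_iff.mp hs
    refine Finset.sum_pos' (fun j _ => sq_nonneg _) ⟨a + 1, ?_, ?_⟩
    · have := a.isLt; simp only [Finset.mem_Icc]; omega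
    · have e : entry s (a + 1) = s a := by
        have := a.isLt
        unfold entry
        rw [dif_pos (by omega)]
        rfl
      rw [e]
      have : s a ≠ 0 := ha
      positivity
  rw [multisumTerm, zero_zpow _ (by omega), zero_mul, zero_mul]

theorem qPochInf_zero_left (q : ℂ) : qPochInf 0 q = 1 := by simp [qPochInf]

theorem multisumTerm_zero_zero (k i : ℕ) : multisumTerm k i 0 (0 : Fin (k - 1) → ℕ) = 1 := by
  have e : ∀ j, entry (0 : Fin (k - 1) → ℕ) j = 0 := fun j => by unfold entry; split_ifs <;> rfl
  have h : invQFactorial 0 0 = 1 := by simp [invQFactorial, qPoch_zero]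
  simp [multisumTerm, e, h, qPoch_zero]

/-- Here `t` is any square root of `q`, so `q ^ (i - 1/2) = t ^ (2 * i - 1)` and
`q ^ (i + 1/2) = t ^ (2 * i + 1)`. -/
theorem proposition4p2 (k i : ℕ) (hk : 2 ≤ k) (hi : 1 ≤ i) (hik : i ≤ k)
    (q t : ℂ) (hq : ‖q‖ < 1) (ht : t ^ 2 = q) :
    HasSum (fun s : Fin (k - 1) → ℕ => multisumTerm k i t s)
      (qPochInf (q ^ (2 * i)) (q ^ (2 * i)) * qPochInf (-t ^ (2 * i - 1)) (q ^ (2 * i))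
        * qPochInf (-t ^ (2 * i + 1)) (q ^ (2 * i)) / qPochInf q q) := by
  subst ht
  rcases eq_or_ne t 0 with rfl | ht0
  · have h := hasSum_single (f := fun s : Fin (k - 1) → ℕ => multisumTerm k i 0 s) 0
      fun s hs => multisumTerm_zero_of_ne_zero k i hi hs
    rw [multisumTerm_zero_zero] at h
    simpa [show 2 * i - 1 ≠ 0 by omega, show i ≠ 0 by omega, qPochInf_zero_left] using h
  have ht1 : ‖t‖ < 1 := by
    rw [norm_pow] at hq
    exact (pow_lt_one_iff_of_nonneg (norm_nonneg t) two_ne_zero).mp hq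
  obtain ⟨m, rfl⟩ := Nat.exists_eq_add_of_le' hk
  obtain ⟨c, rfl⟩ := Nat.exists_eq_add_of_le' hi
  have h := hasSum_multisumTerm ht1 ht0 (m := m) (c := c) (by omega)
  rw [tsum_quadratic_eq ht1 ht0] at h
  rw [← pow_mul, show 2 * (2 * (c + 1)) = 4 * (c + 1) by ring,
    show 2 * (c + 1) - 1 = 2 * c + 1 by omega, show 2 * (c + 1) + 1 = 2 * c + 3 by ring]
  exact h
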